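/- Let $G$ be a compact subgroup of $\mathrm{GL}(n,\mathbb{R})$ acting linearly on $\mathbb{R}^n$, let $p_1,\dots,p_k$ generate the algebra $\mathrm{P}(\mathbb{R}^n,\mathbb{R})^G$ of $G$-invariant real polynomials on $\mathbb{R}^n$, let $\sigma=(p_1,\dots,p_k):\mathbb{R}^n\to\mathbb{R}^k$ be the associated Hilbert map, and identify the orbit space $\mathbb{R}^n/G$ through $\sigma$ with $\Sigma=\sigma(\mathbb{R}^n)\subseteq\mathbb{R}^k$. A polynomial on $\mathbb{R}^n/G$ is the restriction to $\Sigma$ of a polynomial on $\mathbb{R}^k$, and $C^\infty(\mathbb{R}^n/G)=C^\infty(\mathbb{R}^k)|_\Sigma$. For a function $f$ on $\Sigma$ put $\sigma^*f=f\circ\sigma$; for a function $q$ on $\mathbb{R}^n$ that is constant on the fibres of $\sigma$ let $\sigma_*q$ be the function on $\Sigma$ with $\sigma^*(\sigma_*q)=q$. An integral curve through $y\in\Sigma$ of a derivation $D$ of an algebra $A$ of functions on $\Sigma$ is a map $c:I\to\Sigma$, where $I\subseteq\mathbb{R}$ is an interval containing $0$ (possibly $I=\{0\}$), with $c(0)=y$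 and $\frac{d}{dt}f(c(t))=(Df)(c(t))$ for all $t\in I$, $f\in A$ (one-sided derivatives at end points belonging to $I$; no condition if $I=\{0\}$). It is the maximal integral curve through $y$ if every integral curve of $D$ through $y$ is a restriction of it. Lemma 5. Let $X$ be a $G$-invariant polynomial vector field on $\mathbb{R}^n$. Then $X(\sigma^*f)$ is constant on the fibres of $\sigma$ for every polynomial $f$ on $\mathbb{R}^n/G$, and $Y=\sigma_*\circ X\circ\sigma^*$ is a polynomial vector field on $\mathbb{R}^n/G$. That is: $Y$ is a derivation of the algebra of polynomials on $\mathbb{R}^n/G$, with $\sigma^*\circ Y=X\circ\sigma^*$; through every $y\in\mathbb{R}^n/G$ there is a maximal integral curve of $Y$, and its domain is an open interval; and $Y$ is the restriction to polynomials of a vector field on the subcartesian differential space $(\mathbb{R}^n/G,\,C^\infty(\mathbb{R}^n/G))$, that is, of a derivation of $C^\infty(\mathbb{R}^n/G)$ which has through every point a maximal integral curve whose domain is an open interval. -/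

import Mathlib

open scoped ContDiff

noncomputable section

/-- The algebra `P(ℝⁿ, ℝ)^G` of polynomials on `ℝⁿ` invariant under the linear action of a
subgroup `G` of `GL(n, ℝ)`. -/
def invariantPolynomials {n : ℕ} (G : Subgroup (GL (Fin n) ℝ)) :
    Subalgebra ℝ (MvPolynomial (Fin n) ℝ) where
  carrier := {q | ∀ g ∈ G, ∀ x : Fin n → ℝ,
    MvPolynomial.eval (((g⁻¹ : GL (Fin n) ℝ) : Matrix (Fin n) (Fin n) ℝ).mulVec x) q
      = MvPolynomial.eval x q}
  mul_mem' := by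
    intro a b ha hb g hg x
    rw [map_mul, map_mul, ha g hg x, hb g hg x]
  add_mem' := by
    intro a b ha hb g hg x
    rw [map_add, map_add, ha g hg x, hb g hg x]
  algebraMap_mem' := by
    intro r g _ x
    simp [MvPolynomial.algebraMap_eq]

/-- The map `ℝⁿ → ℝⁿ` underlying a polynomial vector field, given by its components. -/
def polyVectorFieldMap {n : ℕ} (X : Fin n → MvPolynomial (Fin n) ℝ) (x : Fin n → ℝ) :
    Fin n → ℝ :=
  fun i => MvPolynomial.eval x (X i)

/-- The polynomial vector field `X` is `G`-invariant: `(Φ_g)_* X = Φ_g ∘ X ∘ Φ_{g⁻¹} = X` for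
every `g` in `G`. -/
def IsInvariantVectorField {n : ℕ} (G : Subgroup (GL (Fin n) ℝ))
    (X : Fin n → MvPolynomial (Fin n) ℝ) : Prop :=
  ∀ g ∈ G, ∀ x : Fin n → ℝ,
    (g : Matrix (Fin n) (Fin n) ℝ).mulVec
      (polyVectorFieldMap X
        (((g⁻¹ : GL (Fin n) ℝ) : Matrix (Fin n) (Fin n) ℝ).mulVec x))
      = polyVectorFieldMap X x

/-- The vector field `X` acting on (differentiable) functions on `ℝⁿ` by directional
derivative: `(X f)(x) = df(x)(X(x)) = ∑ᵢ Xᵢ(x) ∂f/∂xᵢ(x)`. -/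
def applyVectorField {n : ℕ} (X : Fin n → MvPolynomial (Fin n) ℝ) (f : (Fin n → ℝ) → ℝ) :
    (Fin n → ℝ) → ℝ :=
  fun x => fderiv ℝ f x (polyVectorFieldMap X x)

/-- The Hilbert map `σ = (p₁, …, p_k) : ℝⁿ → ℝᵏ`. -/
def hilbertMap {n k : ℕ} (p : Fin k → MvPolynomial (Fin n) ℝ) (x : Fin n → ℝ) : Fin k → ℝ :=
  fun j => MvPolynomial.eval x (p j)

/-- The orbit space `ℝⁿ/G = Σ = σ(ℝⁿ) ⊆ ℝᵏ`. -/
def orbitSpace {n k : ℕ} (p : Fin k → MvPolynomial (Fin n) ℝ) : Set (Fin k → ℝ) :=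
  Set.range (hilbertMap p)

/-- The Hilbert map as a surjection `σ : ℝⁿ → Σ`. -/
def orbitMap {n k : ℕ} (p : Fin k → MvPolynomial (Fin n) ℝ) (x : Fin n → ℝ) : orbitSpace p :=
  ⟨hilbertMap p x, Set.mem_range_self x⟩

/-- `σ^* f = f ∘ σ`. -/
def hilbertPullback {n k : ℕ} (p : Fin k → MvPolynomial (Fin n) ℝ) (f : orbitSpace p → ℝ) :
    (Fin n → ℝ) → ℝ :=
  fun x => f (orbitMap p x)

/-- `σ_* q`: its value at `y ∈ Σ` is the value of `q` at a point of the fibre `σ⁻¹(y)`.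
It is independent of the choice of that point, that is `σ^*(σ_* q) = q`, exactly when
`q` is constant on the fibres of `σ`. -/
def hilbertPushforward {n k : ℕ} (p : Fin k → MvPolynomial (Fin n) ℝ) (q : (Fin n → ℝ) → ℝ) :
    orbitSpace p → ℝ :=
  fun y => q (Classical.choose y.2)

/-- Polynomials on a subset `S` of `ℝᵏ`: the restrictions to `S` of polynomials on `ℝᵏ`. -/
def polynomialsOn {k : ℕ} (S : Set (Fin k → ℝ)) : Subalgebra ℝ (S → ℝ) where
  carrier := {f | ∃ P : MvPolynomial (Fin k) ℝ, ∀ y : S, f y = MvPolynomial.eval y.1 P}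
  mul_mem' := by
    rintro f g ⟨P, hP⟩ ⟨Q, hQ⟩
    exact ⟨P * Q, fun y => by simp [hP y, hQ y]⟩
  add_mem' := by
    rintro f g ⟨P, hP⟩ ⟨Q, hQ⟩
    exact ⟨P + Q, fun y => by simp [hP y, hQ y]⟩
  algebraMap_mem' := by
    intro r
    exact ⟨MvPolynomial.C r, fun y => by simp⟩

/-- The differential structure `C^∞(ℝᵏ)|_S` on a subset `S` of `ℝᵏ`. -/
def smoothFunctionsOn {k : ℕ} (S : Set (Fin k → ℝ)) : Subalgebra ℝ (S → ℝ) where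
  carrier := {f | ∃ F : (Fin k → ℝ) → ℝ, ContDiff ℝ ∞ F ∧ ∀ y : S, f y = F y.1}
  mul_mem' := by
    rintro f g ⟨F, hF, hfF⟩ ⟨H, hH, hgH⟩
    exact ⟨fun y => F y * H y, hF.mul hH, fun y => by simp [hfF y, hgH y]⟩
  add_mem' := by
    rintro f g ⟨F, hF, hfF⟩ ⟨H, hH, hgH⟩
    exact ⟨fun y => F y + H y, hF.add hH, fun y => by simp [hfF y, hgH y]⟩
  algebraMap_mem' := by
    intro r
    exact ⟨fun _ => r, contDiff_const, fun y => by simp⟩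

/-- `c : I → S` is an integral curve through `y` of the derivation `D` of the algebra `A` of
functions on `S`: `I` is an interval containing `0` (the one-point interval `{0}` is allowed),
`c(0) = y`, and `d/dt f(c(t)) = (D f)(c(t))` for all `t ∈ I` and `f ∈ A`, with one-sided
derivatives at end points that belong to `I`. The values of `c` outside `I` play no role. -/
structure IsIntegralCurveThrough {S : Type*} {A : Subalgebra ℝ (S → ℝ)} (D : Derivation ℝ A A)
    (y : S) (c : ℝ → S) (I : Set ℝ) : Prop where
  interval : I.OrdConnected
  zero_mem : (0 : ℝ) ∈ I
  initial : c 0 = y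
  deriv_eq : ∀ f : A, ∀ t ∈ I,
    HasDerivWithinAt (fun s => (f : S → ℝ) (c s)) ((D f : S → ℝ) (c t)) I t

/-- `c : I → S` is the maximal integral curve of `D` through `y`: every integral curve of `D`
through `y` is a restriction of it. -/
def IsMaximalIntegralCurve {S : Type*} {A : Subalgebra ℝ (S → ℝ)} (D : Derivation ℝ A A)
    (y : S) (c : ℝ → S) (I : Set ℝ) : Prop :=
  IsIntegralCurveThrough D y c I ∧
    ∀ (c' : ℝ → S) (I' : Set ℝ), IsIntegralCurveThrough D y c' I' →
      I' ⊆ I ∧ Set.EqOn c' c I'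

/-- Through every point of `S` there is a maximal integral curve of `D`, and its domain is an
open interval. -/
def HasOpenMaximalIntegralCurves {S : Type*} {A : Subalgebra ℝ (S → ℝ)}
    (D : Derivation ℝ A A) : Prop :=
  ∀ y : S, ∃ (c : ℝ → S) (I : Set ℝ), IsMaximalIntegralCurve D y c I ∧ IsOpen I

/-- A derivation `Y` of the algebra of polynomials on `S ⊆ ℝᵏ` is a polynomial vector field on
`S` if the domains of its maximal integral curves are open intervals, and it is the restriction
to polynomials of a vector field `Z` on the differential space `(S, C^∞(ℝᵏ)|_S)`, that is, of a
derivation of `C^∞(ℝᵏ)|_S` whose maximal integral curves have open domains. -/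
def IsPolynomialVectorField {k : ℕ} {S : Set (Fin k → ℝ)}
    (Y : Derivation ℝ (polynomialsOn S) (polynomialsOn S)) : Prop :=
  HasOpenMaximalIntegralCurves Y ∧
    ∃ Z : Derivation ℝ (smoothFunctionsOn S) (smoothFunctionsOn S),
      (∀ (f : polynomialsOn S) (F : smoothFunctionsOn S),
        (F : S → ℝ) = (f : S → ℝ) → (Z F : S → ℝ) = (Y f : S → ℝ)) ∧
      HasOpenMaximalIntegralCurves Z

end

open Set

/-! ### Integral curves of a vector field staying in a set -/

section IntegralCurves

variable {E : Type*} [NormedAddCommGroup E] [NormedSpace ℝ E]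

/-! Differentiating the invariance of `p j` and using that of `X` shows that `X (p j)` is again
invariant, hence a polynomial `Q j` in `p`. So `X` is σ-related to a polynomial vector field `Q` on
ℝᵏ (`exists_hilbertMap_related`), and by the chain rule `X(σ^*F) = σ^*(dF(Q))`. Thus `Y` and its
smooth extension `Z` are both differentiation along `Q`, restricted to Σ.

Their integral curves are those of `Q` that stay in Σ, as the coordinates are test functions
(`isIntegralCurveThrough_iff`). Uniqueness lets all such curves through a point be glued into a
maximal one. A curve of `Q` could leave Σ, but the σ-image of a curve of `X` cannot, so every point
of Σ has a two-sided local curve in Σ. No maximal curve can therefore contain an end point of its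
domain (`exists_maximal_isIntegralCurveOn`). -/

theorem IsIntegralCurveOn.eqOn_of_locallyLipschitz {v : E → E} (hv : LocallyLipschitz v)
    {γ δ : ℝ → E} {I : Set ℝ} (hI : I.OrdConnected)
    (hγ : IsIntegralCurveOn γ (fun _ => v) I) (hδ : IsIntegralCurveOn δ (fun _ => v) I)
    {t₀ : ℝ} (ht₀ : t₀ ∈ I) (h₀ : γ t₀ = δ t₀) : EqOn γ δ I := by
  -- Over a compact subinterval both curves trace compact sets, on whose union a locally Lipschitz
  -- field has a single Lipschitz constant.
  have lip : ∀ a b : ℝ, Icc a b ⊆ I →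
      ∃ K, LipschitzOnWith K v (γ '' Icc a b ∪ δ '' Icc a b) := by
    intro a b hab
    refine LocallyLipschitzOn.exists_lipschitzOnWith_of_compact ?_ hv.locallyLipschitzOn
    exact (isCompact_Icc.image_of_continuousOn fun s hs =>
        ((hγ s (hab hs)).continuousWithinAt.mono hab)).union
      (isCompact_Icc.image_of_continuousOn fun s hs =>
        ((hδ s (hab hs)).continuousWithinAt.mono hab))
  intro t ht
  rcases le_total t₀ t with h | h
  · have hab : Icc t₀ t ⊆ I := hI.out ht₀ ht
    obtain ⟨K, hK⟩ := lip t₀ t hab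
    have right : ∀ η : ℝ → E, IsIntegralCurveOn η (fun _ => v) I →
        ∀ s ∈ Ico t₀ t, HasDerivWithinAt η (v (η s)) (Ici s) s := fun η hη s hs =>
      ((hη s (hab (Ico_subset_Icc_self hs))).mono hab).mono_of_mem_nhdsWithin
        (Icc_mem_nhdsGE_of_mem hs)
    exact ODE_solution_unique_of_mem_Icc_right (v := fun _ => v)
      (s := fun _ => γ '' Icc t₀ t ∪ δ '' Icc t₀ t) (fun _ _ => hK)
      (fun s hs => (hγ s (hab hs)).continuousWithinAt.mono hab) (right γ hγ)
      (fun s hs => .inl (mem_image_of_mem γ (Ico_subset_Icc_self hs)))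
      (fun s hs => (hδ s (hab hs)).continuousWithinAt.mono hab) (right δ hδ)
      (fun s hs => .inr (mem_image_of_mem δ (Ico_subset_Icc_self hs))) h₀
      (right_mem_Icc.2 h)
  · have hab : Icc t t₀ ⊆ I := hI.out ht ht₀
    obtain ⟨K, hK⟩ := lip t t₀ hab
    have left : ∀ η : ℝ → E, IsIntegralCurveOn η (fun _ => v) I →
        ∀ s ∈ Ioc t t₀, HasDerivWithinAt η (v (η s)) (Iic s) s := fun η hη s hs =>
      ((hη s (hab (Ioc_subset_Icc_self hs))).mono hab).mono_of_mem_nhdsWithin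
        (Icc_mem_nhdsLE_of_mem hs)
    exact ODE_solution_unique_of_mem_Icc_left (v := fun _ => v)
      (s := fun _ => γ '' Icc t t₀ ∪ δ '' Icc t t₀) (fun _ _ => hK)
      (fun s hs => (hγ s (hab hs)).continuousWithinAt.mono hab) (left γ hγ)
      (fun s hs => .inl (mem_image_of_mem γ (Ioc_subset_Icc_self hs)))
      (fun s hs => (hδ s (hab hs)).continuousWithinAt.mono hab) (left δ hδ)
      (fun s hs => .inr (mem_image_of_mem δ (Ioc_subset_Icc_self hs))) h₀
      (left_mem_Icc.2 h)

/-- Two integral curves, the second one on an open interval about a point of the first one's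
domain, with equal values at that point, glue to an integral curve on the union. -/
theorem IsIntegralCurveOn.piecewise_Ioo {v : E → E} (hv : LocallyLipschitz v)
    {γ δ : ℝ → E} {I : Set ℝ} [DecidablePred (· ∈ I)] (hI : I.OrdConnected) {t₀ ε : ℝ}
    (hγ : IsIntegralCurveOn γ (fun _ => v) I)
    (hδ : IsIntegralCurveOn δ (fun _ => v) (Ioo (t₀ - ε) (t₀ + ε)))
    (hε : 0 < ε) (ht₀ : t₀ ∈ I) (h₀ : γ t₀ = δ t₀) :
    IsIntegralCurveOn (I.piecewise γ δ) (fun _ => v) (I ∪ Ioo (t₀ - ε) (t₀ + ε)) := by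
  set J := Ioo (t₀ - ε) (t₀ + ε) with hJ
  have ht₀J : t₀ ∈ J := ⟨by linarith, by linarith⟩
  have hγδ : EqOn γ δ (I ∩ J) :=
    IsIntegralCurveOn.eqOn_of_locallyLipschitz hv (hI.inter ordConnected_Ioo)
      (fun t ht => (hγ t ht.1).mono inter_subset_left)
      (fun t ht => (hδ t ht.2).mono inter_subset_right) ⟨ht₀, ht₀J⟩ h₀
  have eqI : EqOn (I.piecewise γ δ) γ I := piecewise_eqOn I γ δ
  have eqJ : EqOn (I.piecewise γ δ) δ J := by
    intro s hs
    by_cases hsI : s ∈ I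
    · rw [eqI hsI, hγδ ⟨hsI, hs⟩]
    · exact piecewise_eq_of_notMem I γ δ hsI
  intro t ht
  by_cases htJ : t ∈ J
  · have hJt : J ∈ nhds t := isOpen_Ioo.mem_nhds htJ
    have h := ((hδ t htJ).congr eqJ (eqJ htJ)).hasDerivAt hJt
    rw [← eqJ htJ] at h
    exact h.hasDerivWithinAt
  · have htI : t ∈ I := ht.resolve_right htJ
    have h := (hγ t htI).congr eqI (eqI htI)
    rw [← eqI htI] at h
    refine h.mono_of_mem_nhdsWithin ?_
    have ht' : t ≤ t₀ - ε ∨ t₀ + ε ≤ t := by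
      by_contra! hcon
      exact htJ ⟨hcon.1, hcon.2⟩
    -- Near `t` the union is just `I`: points of `J` between `t` and `t₀` lie in `I` by convexity.
    rw [mem_nhdsWithin]
    rcases ht' with ht' | ht'
    · refine ⟨Iio t₀, isOpen_Iio, by rw [mem_Iio]; linarith, ?_⟩
      rintro s ⟨hs, hsI | hsJ⟩
      · exact hsI
      · exact hI.out htI ht₀ ⟨by linarith [hsJ.1], (mem_Iio.1 hs).le⟩
    · refine ⟨Ioi t₀, isOpen_Ioi, by rw [mem_Ioi]; linarith, ?_⟩
      rintro s ⟨hs, hsI | hsJ⟩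
      · exact hsI
      · exact hI.out ht₀ htI ⟨(mem_Ioi.1 hs).le, by linarith [hsJ.2]⟩

/-- If a locally Lipschitz vector field `v` has through each point of a set `S` a local integral
curve staying in `S`, then through each point of `S` there is a maximal integral curve among those
staying in `S`, and its domain is an open interval. -/
theorem exists_maximal_isIntegralCurveOn {v : E → E} (hv : LocallyLipschitz v) {S : Set E}
    (hloc : ∀ y : S, ∃ c : ℝ → S, c 0 = y ∧ ∃ ε > (0 : ℝ),
      IsIntegralCurveOn (fun t => (c t : E)) (fun _ => v) (Ioo (-ε) ε)) (y : S) :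
    ∃ (c : ℝ → S) (I : Set ℝ), IsOpen I ∧ I.OrdConnected ∧ 0 ∈ I ∧ c 0 = y ∧
      IsIntegralCurveOn (fun t => (c t : E)) (fun _ => v) I ∧
      ∀ (d : ℝ → S) (J : Set ℝ), J.OrdConnected → 0 ∈ J → d 0 = y →
        IsIntegralCurveOn (fun t => (d t : E)) (fun _ => v) J → J ⊆ I ∧ EqOn d c J := by
  classical
  let P : (ℝ → S) → Set ℝ → Prop := fun d J => J.OrdConnected ∧ 0 ∈ J ∧ d 0 = y ∧
    IsIntegralCurveOn (fun t => (d t : E)) (fun _ => v) J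
  have uniq : ∀ {d J d' J'}, P d J → P d' J' → EqOn d d' (J ∩ J') := by
    rintro d J d' J' ⟨hJ, h0, hy, h⟩ ⟨hJ', h0', hy', h'⟩ t ht
    exact Subtype.ext (IsIntegralCurveOn.eqOn_of_locallyLipschitz hv (hJ.inter hJ')
      (fun s hs => (h s hs.1).mono inter_subset_left)
      (fun s hs => (h' s hs.2).mono inter_subset_right) ⟨h0, h0'⟩ (by simp [hy, hy']) ht)
  have extend : ∀ {d J t}, P d J → t ∈ J → ∃ d' J', P d' J' ∧ J' ∈ nhds t := by
    rintro d J t ⟨hJ, h0, hy, h⟩ ht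
    obtain ⟨e, he0, ε, hε, he⟩ := hloc (d t)
    have hmem : t ∈ Ioo (t - ε) (t + ε) := ⟨by linarith, by linarith⟩
    have he' : IsIntegralCurveOn (fun s => (e (s - t) : E)) (fun _ => v)
        (Ioo (t - ε) (t + ε)) := by
      intro s hs
      have hs' : s - t ∈ Ioo (-ε) ε := ⟨by linarith [hs.1], by linarith [hs.2]⟩
      exact (((he _ hs').hasDerivAt (isOpen_Ioo.mem_nhds hs')).comp_sub_const s t).hasDerivWithinAt
    have glued := IsIntegralCurveOn.piecewise_Ioo hv hJ h he' hε ht (by simp [he0])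
    refine ⟨J.piecewise d fun s => e (s - t), J ∪ Ioo (t - ε) (t + ε), ⟨?_, .inl h0, ?_, ?_⟩,
      Filter.mem_of_superset (isOpen_Ioo.mem_nhds hmem) subset_union_right⟩
    · exact (hJ.isPreconnected.union t ht hmem isPreconnected_Ioo).ordConnected
    · rw [piecewise_eq_of_mem _ _ _ h0, hy]
    · convert glued using 1
      funext s
      by_cases hs : s ∈ J <;> simp [hs]
  -- The union of all domains. By `uniq` the choice made in `c` is immaterial; the default `y` is
  -- never used on `I`.
  let I : Set ℝ := {t | ∃ d J, P d J ∧ t ∈ J}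
  let c : ℝ → S := fun t => if h : t ∈ I then h.choose t else y
  have hc : ∀ {d J}, P d J → EqOn d c J := by
    intro d J hd t ht
    have htI : t ∈ I := ⟨d, J, hd, ht⟩
    obtain ⟨K, hK, htK⟩ := htI.choose_spec
    simp only [c, dif_pos htI]
    exact uniq hd hK ⟨ht, htK⟩
  -- At an isolated point of the domain the derivative condition is vacuous.
  have hy0 : P (fun _ => y) {0} := by
    refine ⟨ordConnected_singleton, rfl, rfl, fun t ht => ?_⟩
    obtain rfl : t = 0 := ht
    exact HasFDerivWithinAt.of_not_accPt (by
      rw [accPt_iff_clusterPt, Filter.inf_principal]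
      simp [ClusterPt])
  have hc0 : c 0 = y := (hc (d := fun _ => y) (J := {0}) hy0 (mem_singleton (0 : ℝ))).symm
  refine ⟨c, I, isOpen_iff_mem_nhds.2 ?_, ?_, ⟨fun _ => y, {0}, hy0, mem_singleton 0⟩, hc0, ?_,
    fun d J hJ h0 hy h => ⟨fun t ht => ⟨d, J, ⟨hJ, h0, hy, h⟩, ht⟩, hc ⟨hJ, h0, hy, h⟩⟩⟩
  · rintro t ⟨d, J, hd, ht⟩
    obtain ⟨d', J', hd', hJ'⟩ := extend hd ht
    exact Filter.mem_of_superset hJ' fun s hs => ⟨d', J', hd', hs⟩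
  · have hI : I = ⋃₀ {J | ∃ d, P d J} := by
      ext t
      simp only [I, mem_ofPred_eq, mem_sUnion]
      exact ⟨fun ⟨d, J, h, ht⟩ => ⟨J, ⟨d, h⟩, ht⟩, fun ⟨J, ⟨d, h⟩, ht⟩ => ⟨d, J, h, ht⟩⟩
    rw [hI]
    refine (isPreconnected_sUnion 0 _ ?_ ?_).ordConnected
    · rintro J ⟨d, hd⟩
      exact hd.2.1
    · rintro J ⟨d, hd⟩
      exact hd.1.isPreconnected
  · rintro t ⟨d, J, hd, ht⟩
    obtain ⟨d', J', hd', hJ'⟩ := extend hd ht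
    have htJ' : t ∈ J' := mem_of_mem_nhds hJ'
    have hcoe : EqOn (fun s => (c s : E)) (fun s => (d' s : E)) J' :=
      fun s hs => congrArg Subtype.val (hc hd' hs).symm
    have h := ((hd'.2.2.2 t htJ').congr hcoe (hcoe htJ')).hasDerivAt hJ'
    have h2 : (c t : E) = d' t := hcoe htJ'
    simp only at h
    rw [← h2] at h
    exact h.hasDerivWithinAt

end IntegralCurves

/-! ### Polynomial vector fields -/

theorem contDiff_eval_mvPolynomial {n : ℕ} (P : MvPolynomial (Fin n) ℝ) {m : WithTop ℕ∞} :
    ContDiff ℝ m fun x : Fin n → ℝ => MvPolynomial.eval x P :=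
  (AnalyticOnNhd.eval_mvPolynomial P).contDiff

theorem differentiable_eval_mvPolynomial {n : ℕ} (P : MvPolynomial (Fin n) ℝ) :
    Differentiable ℝ fun x : Fin n → ℝ => MvPolynomial.eval x P :=
  (contDiff_eval_mvPolynomial P (m := 1)).differentiable one_ne_zero

theorem contDiff_polyVectorFieldMap {n : ℕ} (X : Fin n → MvPolynomial (Fin n) ℝ)
    {m : WithTop ℕ∞} : ContDiff ℝ m (polyVectorFieldMap X) :=
  contDiff_pi.2 fun i => contDiff_eval_mvPolynomial (X i)

theorem contDiff_hilbertMap {n k : ℕ} (p : Fin k → MvPolynomial (Fin n) ℝ) {m : WithTop ℕ∞} :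
    ContDiff ℝ m (hilbertMap p) :=
  contDiff_pi.2 fun j => contDiff_eval_mvPolynomial (p j)

theorem differentiable_hilbertMap {n k : ℕ} (p : Fin k → MvPolynomial (Fin n) ℝ) :
    Differentiable ℝ (hilbertMap p) :=
  (contDiff_hilbertMap p (m := 1)).differentiable one_ne_zero

/-- Both sides are derivations in `P` agreeing on the variables. It serves for `X` on ℝⁿ and for `Q`
on ℝᵏ. -/
theorem applyVectorField_eval {n : ℕ} (X : Fin n → MvPolynomial (Fin n) ℝ)
    (P : MvPolynomial (Fin n) ℝ) :
    applyVectorField X (fun x => MvPolynomial.eval x P)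
      = fun x => MvPolynomial.eval x (MvPolynomial.mkDerivation ℝ X P) := by
  funext x
  unfold applyVectorField
  induction P using MvPolynomial.induction_on with
  | C a => simp
  | add P Q hP hQ =>
    have : (fun x => MvPolynomial.eval x (P + Q))
        = (fun x => MvPolynomial.eval x P) + fun x => MvPolynomial.eval x Q := by
      funext x; simp
    rw [this, fderiv_add (differentiable_eval_mvPolynomial P x)
      (differentiable_eval_mvPolynomial Q x), add_apply, hP, hQ]
    simp
  | mul_X P i hP =>
    have : (fun x => MvPolynomial.eval x (P * MvPolynomial.X i))
        = (fun x => MvPolynomial.eval x P) * fun x => x i := by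
      funext x; simp
    have hi : HasFDerivAt (fun x : Fin n → ℝ => x i) (ContinuousLinearMap.proj (R := ℝ) i) x :=
      hasFDerivAt_apply i x
    rw [this, fderiv_mul (differentiable_eval_mvPolynomial P x) hi.differentiableAt, hi.fderiv]
    simp [hP, polyVectorFieldMap]

/-- Differentiate `P ∘ g⁻¹ = P` at `x` in the direction `X(x)`, and use `g⁻¹ X(x) = X(g⁻¹ x)`. -/
theorem mkDerivation_mem_invariantPolynomials {n : ℕ} {G : Subgroup (GL (Fin n) ℝ)}
    {X : Fin n → MvPolynomial (Fin n) ℝ} (hX : IsInvariantVectorField G X)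
    {P : MvPolynomial (Fin n) ℝ} (hP : P ∈ invariantPolynomials G) :
    MvPolynomial.mkDerivation ℝ X P ∈ invariantPolynomials G := by
  intro g hg x
  set h : (Fin n → ℝ) → ℝ := fun x => MvPolynomial.eval x P with hh
  let L : (Fin n → ℝ) →L[ℝ] (Fin n → ℝ) := LinearMap.toContinuousLinearMap
    (Matrix.mulVecLin ((g⁻¹ : GL (Fin n) ℝ) : Matrix (Fin n) (Fin n) ℝ))
  have hL : ∀ z, L z = ((g⁻¹ : GL (Fin n) ℝ) : Matrix (Fin n) (Fin n) ℝ).mulVec z := fun z => rfl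
  have hcomp : h ∘ L = h := funext fun z => hP g hg z
  have hder : fderiv ℝ h x = (fderiv ℝ h (L x)).comp L := by
    conv_lhs => rw [← hcomp]
    rw [fderiv_comp x (differentiable_eval_mvPolynomial P _) L.differentiableAt, L.fderiv]
  have hXL : L (polyVectorFieldMap X x) = polyVectorFieldMap X (L x) := by
    rw [← hX g hg x, hL, hL, Matrix.mulVec_mulVec, ← Units.val_mul, inv_mul_cancel]
    simp
  have := congrFun (applyVectorField_eval X P)
  simp only [← this, ← hL]
  change fderiv ℝ h (L x) _ = fderiv ℝ h x _
  rw [hder, ContinuousLinearMap.comp_apply, hXL]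

/-- An invariant polynomial vector field on `ℝⁿ` is related by the Hilbert map to a polynomial
vector field on `ℝᵏ`. -/
theorem exists_hilbertMap_related {n k : ℕ} {G : Subgroup (GL (Fin n) ℝ)}
    {p : Fin k → MvPolynomial (Fin n) ℝ}
    (hp : Algebra.adjoin ℝ (Set.range p) = invariantPolynomials G)
    {X : Fin n → MvPolynomial (Fin n) ℝ} (hX : IsInvariantVectorField G X) :
    ∃ Q : Fin k → MvPolynomial (Fin k) ℝ, ∀ x,
      fderiv ℝ (hilbertMap p) x (polyVectorFieldMap X x)
        = polyVectorFieldMap Q (hilbertMap p x) := by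
  have key : ∀ j, ∃ Q : MvPolynomial (Fin k) ℝ,
      MvPolynomial.aeval p Q = MvPolynomial.mkDerivation ℝ X (p j) := by
    intro j
    have hj : p j ∈ invariantPolynomials G := hp ▸ Algebra.subset_adjoin (mem_range_self j)
    have := mkDerivation_mem_invariantPolynomials hX hj
    rwa [← hp, Algebra.adjoin_range_eq_range_aeval] at this
  choose Q hQ using key
  refine ⟨Q, fun x => funext fun j => ?_⟩
  have hj : fderiv ℝ (hilbertMap p) x (polyVectorFieldMap X x) j
      = applyVectorField X (fun x => MvPolynomial.eval x (p j)) x := by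
    unfold applyVectorField hilbertMap
    rw [fderiv_pi fun j => differentiable_eval_mvPolynomial (p j) x]
    rfl
  rw [hj, applyVectorField_eval, ← hQ j]
  simp only [polyVectorFieldMap]
  rw [MvPolynomial.aeval_eq_bind₁, MvPolynomial.eval, MvPolynomial.eval₂Hom_bind₁]
  rfl

/-! ### Derivations of function algebras induced by a vector field -/

theorem hilbertPullback_hilbertPushforward {n k : ℕ} {p : Fin k → MvPolynomial (Fin n) ℝ}
    {q : (Fin n → ℝ) → ℝ} (hq : ∀ x x', hilbertMap p x = hilbertMap p x' → q x = q x') :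
    hilbertPullback p (hilbertPushforward p q) = q :=
  funext fun x => hq _ _ (Classical.choose_spec (orbitMap p x).2)

/-- The derivation `f ↦ dF(v)|_S`, for `F` an extension of `f`, of an algebra `A` of functions
on `S`, expressed by a map `d` known to compute it. -/
def derivationOfExtension {E : Type*} [NormedAddCommGroup E] [NormedSpace ℝ E] {S : Set E}
    (A : Subalgebra ℝ (S → ℝ)) (v : E → E) (d : (S → ℝ) → S → ℝ)
    (hd : ∀ F : E → ℝ, Differentiable ℝ F →
      d (fun y => F y) = fun y : S => fderiv ℝ F y (v y))
    (hA : ∀ f ∈ A, ∃ F : E → ℝ, Differentiable ℝ F ∧ f = fun y : S => F y)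
    (hdA : ∀ f ∈ A, d f ∈ A) : Derivation ℝ A A :=
  -- Since `d` is given beforehand, independence of the extension needs no proof; each law is
  -- checked on chosen extensions.
  Derivation.mk'
    { toFun := fun f => ⟨d f, hdA f f.2⟩
      map_add' := by
        rintro ⟨f, hf⟩ ⟨g, hg⟩
        obtain ⟨F, hF, rfl⟩ := hA f hf
        obtain ⟨H, hH, rfl⟩ := hA g hg
        refine Subtype.ext ((hd (F + H) (hF.add hH)).trans ?_)
        change _ = d (fun y => F y) + d (fun y => H y)
        rw [hd F hF, hd H hH]
        funext y
        rw [fderiv_add (hF _) (hH _)]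
        rfl
      map_smul' := by
        rintro r ⟨f, hf⟩
        obtain ⟨F, hF, rfl⟩ := hA f hf
        refine Subtype.ext ((hd (r • F) (hF.const_smul r)).trans ?_)
        change _ = r • d (fun y => F y)
        rw [hd F hF]
        funext y
        rw [fderiv_const_smul (hF _)]
        rfl }
    (by
      rintro ⟨f, hf⟩ ⟨g, hg⟩
      obtain ⟨F, hF, rfl⟩ := hA f hf
      obtain ⟨H, hH, rfl⟩ := hA g hg
      refine Subtype.ext ((hd (F * H) (hF.mul hH)).trans ?_)
      change _ = (fun y : S => F y) * d (fun y => H y) + (fun y : S => H y) * d (fun y => F y)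
      rw [hd F hF, hd H hH]
      funext y
      rw [fderiv_mul (hF _) (hH _)]
      rfl)

/-- Integral curves of a derivation of functions on `S ⊆ ℝᵏ` induced by a vector field `v` are the
integral curves of `v` staying in `S`. -/
theorem isIntegralCurveThrough_iff {k : ℕ} {S : Set (Fin k → ℝ)} {A : Subalgebra ℝ (S → ℝ)}
    {D : Derivation ℝ A A} {v : (Fin k → ℝ) → Fin k → ℝ}
    (hA : ∀ f ∈ A, ∃ F : (Fin k → ℝ) → ℝ, Differentiable ℝ F ∧ f = fun y : S => F y)
    (hcoord : ∀ j, (fun y : S => y.1 j) ∈ A)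
    (hD : ∀ (f : A) (F : (Fin k → ℝ) → ℝ), Differentiable ℝ F → (f : S → ℝ) = (fun y : S => F y) →
      (D f : S → ℝ) = fun y : S => fderiv ℝ F y (v y))
    {y : S} {c : ℝ → S} {I : Set ℝ} :
    IsIntegralCurveThrough D y c I ↔ I.OrdConnected ∧ 0 ∈ I ∧ c 0 = y ∧
      IsIntegralCurveOn (fun t => (c t : Fin k → ℝ)) (fun _ => v) I := by
  constructor
  · rintro ⟨hI, h0, hy, h⟩
    refine ⟨hI, h0, hy, fun t ht => hasDerivWithinAt_pi.2 fun j => ?_⟩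
    have hj : HasFDerivAt (fun x : Fin k → ℝ => x j) (ContinuousLinearMap.proj (R := ℝ) j)
        (c t : Fin k → ℝ) := hasFDerivAt_apply j _
    have := h ⟨_, hcoord j⟩ t ht
    rw [hD ⟨_, hcoord j⟩ (fun x => x j) (differentiable_apply j) rfl] at this
    simpa [hj.fderiv] using this
  · rintro ⟨hI, h0, hy, h⟩
    refine ⟨hI, h0, hy, fun f t ht => ?_⟩
    obtain ⟨F, hF, hfF⟩ := hA f f.2
    rw [hD f F hF hfF, hfF]
    exact (hF _).hasFDerivAt.comp_hasDerivWithinAt t (h t ht)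

/-- Only `v` matters, not `A`, so this covers polynomials and smooth functions alike. -/
theorem hasOpenMaximalIntegralCurves_of_extension {k : ℕ} {S : Set (Fin k → ℝ)}
    {A : Subalgebra ℝ (S → ℝ)} {D : Derivation ℝ A A} {v : (Fin k → ℝ) → Fin k → ℝ}
    (hA : ∀ f ∈ A, ∃ F : (Fin k → ℝ) → ℝ, Differentiable ℝ F ∧ f = fun y : S => F y)
    (hcoord : ∀ j, (fun y : S => y.1 j) ∈ A)
    (hD : ∀ (f : A) (F : (Fin k → ℝ) → ℝ), Differentiable ℝ F → (f : S → ℝ) = (fun y : S => F y) →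
      (D f : S → ℝ) = fun y : S => fderiv ℝ F y (v y))
    (hv : LocallyLipschitz v)
    (hloc : ∀ y : S, ∃ c : ℝ → S, c 0 = y ∧ ∃ ε > (0 : ℝ),
      IsIntegralCurveOn (fun t => (c t : Fin k → ℝ)) (fun _ => v) (Ioo (-ε) ε)) :
    HasOpenMaximalIntegralCurves D := by
  intro y
  obtain ⟨c, I, hIo, hI, h0, hy, h, hmax⟩ := exists_maximal_isIntegralCurveOn hv hloc y
  refine ⟨c, I, ⟨(isIntegralCurveThrough_iff hA hcoord hD).2 ⟨hI, h0, hy, h⟩, ?_⟩, hIo⟩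
  intro d J hd
  obtain ⟨hJ, h0J, hdy, hd⟩ := (isIntegralCurveThrough_iff hA hcoord hD).1 hd
  exact hmax d J hJ h0J hdy hd

/-- The image under the Hilbert map of an integral curve of `X` is a local integral curve in the
orbit space of every vector field related to `X`. -/
theorem exists_local_isIntegralCurveOn_orbitSpace {n k : ℕ} {p : Fin k → MvPolynomial (Fin n) ℝ}
    {X : Fin n → MvPolynomial (Fin n) ℝ} {v : (Fin k → ℝ) → Fin k → ℝ}
    (hrel : ∀ x, fderiv ℝ (hilbertMap p) x (polyVectorFieldMap X x) = v (hilbertMap p x))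
    (y : orbitSpace p) :
    ∃ c : ℝ → orbitSpace p, c 0 = y ∧ ∃ ε > (0 : ℝ),
      IsIntegralCurveOn (fun t => (c t : Fin k → ℝ)) (fun _ => v) (Ioo (-ε) ε) := by
  obtain ⟨_, x, rfl⟩ := y
  obtain ⟨γ, hγ0, ε, hε, hγ⟩ :=
    (contDiff_polyVectorFieldMap X).contDiffAt
      (x := x) |>.exists_forall_mem_closedBall_exists_eq_forall_mem_Ioo_hasDerivAt₀ 0
  refine ⟨fun t => orbitMap p (γ t), Subtype.ext (congrArg (hilbertMap p) hγ0), ε, hε, fun t ht => ?_⟩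
  have h := (differentiable_hilbertMap p (γ t)).hasFDerivAt.comp_hasDerivAt t
    (hγ t (by simpa using ht))
  rw [hrel] at h
  exact h.hasDerivWithinAt

/-! ### Descent of invariant vector fields to the orbit space -/

section Descent

variable {n k : ℕ} {p : Fin k → MvPolynomial (Fin n) ℝ} {X : Fin n → MvPolynomial (Fin n) ℝ}
  {Q : Fin k → MvPolynomial (Fin k) ℝ}

theorem applyVectorField_hilbertPullback
    (hrel : ∀ x, fderiv ℝ (hilbertMap p) x (polyVectorFieldMap X x)
      = polyVectorFieldMap Q (hilbertMap p x))
    {F : (Fin k → ℝ) → ℝ} (hF : Differentiable ℝ F) (x : Fin n → ℝ) :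
    applyVectorField X (hilbertPullback p fun y => F y) x
      = fderiv ℝ F (hilbertMap p x) (polyVectorFieldMap Q (hilbertMap p x)) := by
  have h : (hilbertPullback p fun y => F y) = F ∘ hilbertMap p := rfl
  rw [applyVectorField, h, fderiv_comp x (hF _) (differentiable_hilbertMap p x),
    ContinuousLinearMap.comp_apply, hrel]

/-- The left side sees only the restriction of `F` to Σ, so `dF(Q)` on Σ does not depend on the
extension `F`. -/
theorem hilbertPushforward_applyVectorField
    (hrel : ∀ x, fderiv ℝ (hilbertMap p) x (polyVectorFieldMap X x)
      = polyVectorFieldMap Q (hilbertMap p x))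
    (F : (Fin k → ℝ) → ℝ) (hF : Differentiable ℝ F) :
    hilbertPushforward p (applyVectorField X (hilbertPullback p fun y => F y))
      = fun y : orbitSpace p => fderiv ℝ F y (polyVectorFieldMap Q y) := by
  funext y
  have hy : hilbertMap p (Classical.choose y.2) = y := Classical.choose_spec y.2
  rw [hilbertPushforward, applyVectorField_hilbertPullback hrel hF, hy]

end Descent

theorem exists_differentiable_of_mem_polynomialsOn {k : ℕ} {S : Set (Fin k → ℝ)} (f : S → ℝ)
    (hf : f ∈ polynomialsOn S) :
    ∃ F : (Fin k → ℝ) → ℝ, Differentiable ℝ F ∧ f = fun y : S => F y := by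
  obtain ⟨P, hP⟩ := hf
  exact ⟨_, differentiable_eval_mvPolynomial P, funext hP⟩

theorem exists_differentiable_of_mem_smoothFunctionsOn {k : ℕ} {S : Set (Fin k → ℝ)} (f : S → ℝ)
    (hf : f ∈ smoothFunctionsOn S) :
    ∃ F : (Fin k → ℝ) → ℝ, Differentiable ℝ F ∧ f = fun y : S => F y := by
  obtain ⟨F, hF, hfF⟩ := hf
  exact ⟨F, hF.differentiable (by simp), funext hfF⟩

theorem lemma5 {n k : ℕ} (G : Subgroup (GL (Fin n) ℝ))
    (hG : IsCompact (G : Set (GL (Fin n) ℝ)))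
    (p : Fin k → MvPolynomial (Fin n) ℝ)
    (hp : Algebra.adjoin ℝ (Set.range p) = invariantPolynomials G)
    (X : Fin n → MvPolynomial (Fin n) ℝ)
    (hX : IsInvariantVectorField G X) :
    ∃ Y : Derivation ℝ (polynomialsOn (orbitSpace p)) (polynomialsOn (orbitSpace p)),
      (∀ f : polynomialsOn (orbitSpace p),
        (Y f : orbitSpace p → ℝ)
          = hilbertPushforward p (applyVectorField X (hilbertPullback p f))) ∧
      (∀ f : polynomialsOn (orbitSpace p),
        hilbertPullback p (Y f) = applyVectorField X (hilbertPullback p f)) ∧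
      IsPolynomialVectorField Y := by
  obtain ⟨Q, hrel⟩ := exists_hilbertMap_related hp hX
  have hd := hilbertPushforward_applyVectorField hrel
  have hlip : LocallyLipschitz (polyVectorFieldMap Q) :=
    (contDiff_polyVectorFieldMap Q).locallyLipschitz
  have hloc := exists_local_isIntegralCurveOn_orbitSpace hrel
  let Y : Derivation ℝ (polynomialsOn (orbitSpace p)) (polynomialsOn (orbitSpace p)) :=
    derivationOfExtension _ (polyVectorFieldMap Q)
      (fun f => hilbertPushforward p (applyVectorField X (hilbertPullback p f))) hd
      exists_differentiable_of_mem_polynomialsOn (by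
        rintro f ⟨P, hP⟩
        -- Differentiation along `Q` keeps polynomials polynomial.
        refine ⟨MvPolynomial.mkDerivation ℝ Q P, fun y => ?_⟩
        rw [funext hP, hd _ (differentiable_eval_mvPolynomial P)]
        exact congrFun (applyVectorField_eval Q P) y)
  let Z : Derivation ℝ (smoothFunctionsOn (orbitSpace p)) (smoothFunctionsOn (orbitSpace p)) :=
    derivationOfExtension _ (polyVectorFieldMap Q)
      (fun f => hilbertPushforward p (applyVectorField X (hilbertPullback p f))) hd
      exists_differentiable_of_mem_smoothFunctionsOn (by
        rintro f ⟨F, hF, hfF⟩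
        refine ⟨fun y => fderiv ℝ F y (polyVectorFieldMap Q y),
          (hF.fderiv_right (by simp)).clm_apply (contDiff_polyVectorFieldMap Q), fun y => ?_⟩
        rw [funext hfF, hd _ (hF.differentiable (by simp))])
  refine ⟨Y, fun f => rfl, fun f => ?_, ?_, Z, ?_, ?_⟩
  · obtain ⟨F, hF, hfF⟩ := exists_differentiable_of_mem_polynomialsOn f.1 f.2
    change hilbertPullback p
      (hilbertPushforward p (applyVectorField X (hilbertPullback p (f : orbitSpace p → ℝ)))) = _
    refine hilbertPullback_hilbertPushforward fun x x' hxx' => ?_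
    -- Constancy on fibres: `X(σ^*F)` at `x` is `dF(Q)` at `σ(x)`.
    rw [hfF, applyVectorField_hilbertPullback hrel hF, applyVectorField_hilbertPullback hrel hF,
      hxx']
  · refine hasOpenMaximalIntegralCurves_of_extension exists_differentiable_of_mem_polynomialsOn
      (fun j => ⟨MvPolynomial.X j, fun y => by simp⟩) (fun f F hF hfF => ?_) hlip hloc
    rw [← hd F hF, ← hfF]
    rfl
  · intro f F hFf
    change hilbertPushforward p (applyVectorField X (hilbertPullback p F.1)) = _
    rw [hFf]
    rfl
  · refine hasOpenMaximalIntegralCurves_of_extension exists_differentiable_of_mem_smoothFunctionsOn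
      (fun j => ⟨fun y => y j, contDiff_apply ℝ ℝ j, fun y => rfl⟩) (fun f F hF hfF => ?_) hlip hloc
    rw [← hd F hF, ← hfF]
    rfl
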